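/- Let $m\ge 2$, let $1\le k\le m$ be an integer, and let $t$ be an odd integer with $1\le t\le 2^m+1$. Put $s_1=2^{k-1}t-\frac{t-1}{2}$, $s_2=2^{k-1}t+\frac{t+1}{2}$, $d_1=s_1(2^m-1)+1$, $d_2=s_2(2^m-1)+1$ and $l=\gcd(t,2^m+1)$. Assume that $(2^k-1)t\not\equiv 0$ and $(2^k+1)t\not\equiv 0 \pmod{2^m+1}$, and that at least one of the following conditions holds: (i) $m\equiv -1\pmod k$; (ii) $\gcd(k,2m)=1$. For $a,b\in\mathbb{F}_{2^{2m}}$ let $$T_1(a,b)=\sum_{x\in\mathbb{F}_{2^{2m}}}(-1)^{\mathrm{Tr}(ax^{d_1}+bx^{d_2})},$$ where $\mathrm{Tr}$ is the absolute trace from $\mathbb{F}_{2^{2m}}$ to $\mathbb{F}_2$. Then $T_1(0,0)=2^{2m}$, and $T_1(a,b)\in\{-2^m,\,(l-1)2^m,\,(2l-1)2^m,\,(3l-1)2^m\}$ for all $(a,b)\neq(0,0)$. The numbers of pairs $(a,b)\in\mathbb{F}_{2^{2m}}^2$ for which $T_1(a,b)$ equals a given value are as follows. - The value $2^{2m}$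 is taken exactly once. - The value $(3l-1)2^m$ is taken $\dfrac{(2^{2m}-1)(2^m+1-2l)(2^m+1-l)}{6l^3}$ times. - The value $(2l-1)2^m$ is taken $\dfrac{(2^{2m}-1)((2^m+3)l-2^m-1)(2^m+1-l)}{2l^3}$ times. - The value $(l-1)2^m$ is taken $\dfrac{(2^{2m}-1)\left((2^{2m+1}+2^{m+2}+6)l^2-(2^{2m+1}+7\cdot 2^m+5)l+(2^m+1)^2\right)}{2l^3}$ times. - The value $-2^m$ is taken $\dfrac{(2^{2m}-1)\left(6(2^{2m}+1)l^3-(6\cdot 2^{2m}+9\cdot 2^m+11)l^2+(3\cdot 2^{2m}+9\cdot 2^m+6)l-(2^m+1)^2\right)}{6l^3}$ times. -/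

import Mathlib

/-- The absolute trace character sum over a finite field `F` of characteristic two,
`T₁(a,b) = ∑_{x ∈ F} (-1)^{Tr(a x^{d₁} + b x^{d₂})}`, where `Tr` is the trace from `F` to the
field with two elements. It is an integer. -/
noncomputable def binaryExpSum (F : Type*) [Field F] [Fintype F] [Algebra (ZMod 2) F]
    (d₁ d₂ : ℕ) (a b : F) : ℤ :=
  ∑ x : F, (-1 : ℤ) ^ (Algebra.trace (ZMod 2) F (a * x ^ d₁ + b * x ^ d₂)).val

/-- The frequency of the value `v`: the number of pairs `(a,b) ∈ F × F` with `T₁(a,b) = v`. -/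
noncomputable def valueFrequency (F : Type*) [Field F] [Fintype F] [Algebra (ZMod 2) F]
    (d₁ d₂ : ℕ) (v : ℤ) : ℕ :=
  (Finset.univ.filter fun ab : F × F => binaryExpSum F d₁ d₂ ab.1 ab.2 = v).card

/-! Write q = 2^m. Both exponents are 1 mod q - 1, so h(x) = a x^d₁ + b x^d₂ is homogeneous of
degree 1 over the subfield of q elements. Averaging the sum over nonzero subfield scalings turns it
into a count: T₁(a,b) = (lN - 1)q, where N is the number of zeros of b v^(2^k+1) + a v^(2^k) + a^q v
+ b^q in the group V of ((q-1)t)-th powers, a subgroup of the unit circle with M = (q+1)/l elements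
(`binaryExpSum_eq`).

The key fact is N < 4 for (a,b) ≠ (0,0) (`eq_zero_of_niho_eq_zero`). Generically a zero satisfies
v^(2^k) = μ(v) for a Möbius map μ, and v^q = 1/v on the unit circle. Hence the cross-ratio of four
zeros is fixed by the k-th and m-th powers of Frobenius. Both alternatives in the hypothesis give
gcd(k, m) = 1, so the cross-ratio is 0 or 1, impossible for distinct points.

Each point imposes an additive condition costing a factor of at most q, and four points cut q^4
pairs down to one, so j ≤ 4 points leave exactly q^(4-j) pairs (`card_nihoKernel`). This gives the
binomial moments of N (`sum_choose_nihoCount`), and those with j = 0, 1, 2, 3 determine the four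
unknown frequencies. -/

/-! ### Cross-ratios and zeros on the unit circle. -/

section FourPoints

variable {F : Type*} [Field F]

/-- The polynomial condition attached to a point `v`, as a function of the coefficients. -/
def niho (q r : ℕ) (v : F) (ab : F × F) : F :=
  ab.2 * v ^ (r + 1) + ab.1 * v ^ r + ab.1 ^ q * v + ab.2 ^ q

theorem eq_zero_or_eq_one_of_pow_eq [CharP F 2] {k m : ℕ} (hkm : k.Coprime m) {c : F}
    (hk : c ^ 2 ^ k = c) (hm : c ^ 2 ^ m = c) : c = 0 ∨ c = 1 := by
  have periodic (n : ℕ) (h : c ^ 2 ^ n = c) :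
      Function.IsPeriodicPt (frobenius F 2) n c := by
    rw [Function.IsPeriodicPt, Function.IsFixedPt, iterate_frobenius]; exact h
  have h := (periodic k hk).gcd (periodic m hm)
  rw [hkm.gcd_eq_one, Function.IsPeriodicPt, Function.IsFixedPt, Function.iterate_one,
    frobenius_def] at h
  have : c * (c - 1) = 0 := by linear_combination h
  rcases mul_eq_zero.1 this with h | h
  · exact Or.inl h
  · exact Or.inr (sub_eq_zero.1 h)

/-- When the Möbius determinant vanishes, b times the polynomial splits into two factors, each with
at most one root. -/
theorem niho_degenerate [CharP F 2] {k m : ℕ} {a b : F} (hb : b ≠ 0)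
    (hdet : a * a ^ 2 ^ m = b * b ^ 2 ^ m) {v : F}
    (hv : niho (2 ^ m) (2 ^ k) v (a, b) = 0) :
    v = a / b ∨ v ^ 2 ^ k = a ^ 2 ^ m / b := by
  have h2 : (2 : F) = 0 := CharTwo.two_eq_zero
  simp only [niho] at hv
  have : (b * v ^ 2 ^ k - a ^ 2 ^ m) * (b * v - a) = 0 := by
    linear_combination b * hv + hdet + (-(a * b * v ^ 2 ^ k)
      - b * a ^ 2 ^ m * v) * h2
  rcases mul_eq_zero.1 this with h | h
  · right; rw [eq_div_iff hb]; linear_combination h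
  · left; rw [eq_div_iff hb]; linear_combination h

theorem pow_two_pow_sub [CharP F 2] (x y : F) (k : ℕ) :
    (x - y) ^ 2 ^ k = x ^ 2 ^ k - y ^ 2 ^ k := sub_pow_char_pow x y k

/-- Four distinct points of the unit circle impose independent conditions. -/
theorem eq_zero_of_niho_eq_zero [CharP F 2] {k m : ℕ} (hkm : k.Coprime m) {a b : F}
    {v : Fin 4 → F} (hinj : Function.Injective v) (hunit : ∀ i, v i ^ (2 ^ m + 1) = 1)
    (hv : ∀ i, niho (2 ^ m) (2 ^ k) (v i) (a, b) = 0) : a = 0 ∧ b = 0 := by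
  have h2 : (2 : F) = 0 := CharTwo.two_eq_zero
  by_contra hab
  have hpos : 2 ^ m ≠ 0 := by positivity
  by_cases hdet : a * a ^ 2 ^ m = b * b ^ 2 ^ m
  · have hb : b ≠ 0 := by
      rintro rfl
      have : a * a ^ 2 ^ m = 0 := by simpa [hpos] using hdet
      exact hab ⟨by simpa [hpos] using this, rfl⟩
    have key (i j : Fin 4) (hi : v i ^ 2 ^ k = a ^ 2 ^ m / b)
        (hj : v j ^ 2 ^ k = a ^ 2 ^ m / b) : i = j := by
      apply hinj
      have : (v i - v j) ^ 2 ^ k = 0 := by rw [pow_two_pow_sub, hi, hj, sub_self]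
      exact sub_eq_zero.1 (pow_eq_zero_iff (by positivity) |>.1 this)
    have key' (i j : Fin 4) (hi : v i = a / b) (hj : v j = a / b) : i = j :=
      hinj (hi.trans hj.symm)
    -- Three points already suffice: two of them share a factor.
    rcases niho_degenerate hb hdet (hv 0) with h0 | h0 <;>
    rcases niho_degenerate hb hdet (hv 1) with h1 | h1 <;>
    rcases niho_degenerate hb hdet (hv 2) with h3 | h3 <;>
    first
      | exact absurd (key 0 1 h0 h1) (by decide)
      | exact absurd (key 0 2 h0 h3) (by decide)
      | exact absurd (key 1 2 h1 h3) (by decide)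
      | exact absurd (key' 0 1 h0 h1) (by decide)
      | exact absurd (key' 0 2 h0 h3) (by decide)
      | exact absurd (key' 1 2 h1 h3) (by decide)
  · set δ := a * a ^ 2 ^ m - b * b ^ 2 ^ m with hδ
    have hδ0 : δ ≠ 0 := sub_ne_zero.2 hdet
    -- At a pole of μ the numerator would vanish too, forcing δ = 0.
    have hD (i : Fin 4) : b * v i + a ≠ 0 := by
      intro h
      have h' := hv i
      simp only [niho] at h'
      have h'' : a ^ 2 ^ m * v i + b ^ 2 ^ m = 0 := by
        linear_combination h' - v i ^ 2 ^ k * h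
      apply hδ0
      linear_combination a ^ 2 ^ m * h - b * h''
    -- The difference formula for Möbius images; in the cross-ratio δ and the denominators cancel.
    -- The next identity is the same for v ↦ 1/v.
    have hk (i j : Fin 4) : (v i - v j) ^ 2 ^ k * ((b * v i + a) * (b * v j + a))
        = δ * (v i - v j) := by
      have hi := hv i
      have hj := hv j
      simp only [niho] at hi hj
      rw [pow_two_pow_sub]
      linear_combination (b * v j + a) * hi - (b * v i + a) * hj
        - (a * a ^ 2 ^ m - b * b ^ 2 ^ m) * (v i - v j) * h2
    have hm (i j : Fin 4) : (v i - v j) ^ 2 ^ m * (v i * v j) = v i - v j := by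
      have hi := hunit i
      have hj := hunit j
      rw [pow_succ] at hi hj
      rw [pow_two_pow_sub]
      linear_combination v j * hi - v i * hj - (v i - v j) * h2
    have hu (i : Fin 4) : v i ≠ 0 := by
      intro h; simpa [h] using hunit i
    have hne (i j : Fin 4) (h : i ≠ j) : v i - v j ≠ 0 := sub_ne_zero.2 (hinj.ne h)
    have h01 := hne 0 1 (by decide)
    have h23 := hne 2 3 (by decide)
    have h02 := hne 0 2 (by decide)
    have h13 := hne 1 3 (by decide)
    have h03 := hne 0 3 (by decide)
    have h12 := hne 1 2 (by decide)
    have hpk (i j : Fin 4) : (v i - v j) ^ 2 ^ k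
        = δ * (v i - v j) / ((b * v i + a) * (b * v j + a)) := by
      rw [eq_div_iff (mul_ne_zero (hD i) (hD j)), hk]
    have hpm (i j : Fin 4) : (v i - v j) ^ 2 ^ m = (v i - v j) / (v i * v j) := by
      rw [eq_div_iff (mul_ne_zero (hu i) (hu j)), hm]
    have d0 := hD 0
    have d1 := hD 1
    have d2 := hD 2
    have d3 := hD 3
    have u0 := hu 0
    have u1 := hu 1
    have u2 := hu 2
    have u3 := hu 3
    rcases eq_zero_or_eq_one_of_pow_eq hkm
      (c := (v 0 - v 1) * (v 2 - v 3) / ((v 0 - v 2) * (v 1 - v 3)))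
      (by
        simp only [div_pow, mul_pow, hpk]
        generalize b * v 0 + a = e0 at *
        generalize b * v 1 + a = e1 at *
        generalize b * v 2 + a = e2 at *
        generalize b * v 3 + a = e3 at *
        field_simp)
      (by
        simp only [div_pow, mul_pow, hpm]
        field_simp) with h | h
    · exact div_ne_zero (mul_ne_zero h01 h23) (mul_ne_zero h02 h13) h
    -- Cross-ratio 1 is equivalent to (v 0 - v 3)(v 1 - v 2) = 0.
    · rw [div_eq_one_iff_eq (mul_ne_zero h02 h13)] at h
      apply mul_ne_zero h03 h12
      linear_combination -h

end FourPoints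

/-! ### Additive characters and sums over the subfield of index two. -/

section TraceSign

variable {F : Type*} [Field F] [Fintype F] [Algebra (ZMod 2) F]

/-- The canonical additive character of a field of characteristic two. -/
noncomputable def traceSign (x : F) : ℤ := (-1) ^ (Algebra.trace (ZMod 2) F x).val

omit [Fintype F] in
@[simp] theorem traceSign_zero : traceSign (0 : F) = 1 := by simp [traceSign]

omit [Fintype F] in
theorem traceSign_add (x y : F) : traceSign (x + y) = traceSign x * traceSign y := by
  have (u v : ZMod 2) : (-1 : ℤ) ^ (u + v).val = (-1) ^ u.val * (-1) ^ v.val := by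
    revert u v; decide
  rw [traceSign, map_add, this]; rfl

omit [Fintype F] in
theorem traceSign_eq_neg_one {x : F} (hx : Algebra.trace (ZMod 2) F x ≠ 0) :
    traceSign x = -1 := by
  have (u : ZMod 2) (hu : u ≠ 0) : (-1 : ℤ) ^ u.val = -1 := by
    revert u; decide
  exact this _ hx

theorem sum_traceSign_mul {g : F} (hg : g ≠ 0) : ∑ x : F, traceSign (x * g) = 0 := by
  obtain ⟨b, hb⟩ : ∃ b : F, Algebra.trace (ZMod 2) F (g * b) ≠ 0 := by
    have htr := (traceForm_nondegenerate (ZMod 2) F).1 g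
    simp_rw [Algebra.traceForm_apply] at htr
    by_contra! hf
    exact hg (htr hf)
  have h : ∑ x : F, traceSign (x * g) = ∑ x : F, traceSign ((b + x) * g) :=
    (Equiv.sum_comp (Equiv.addLeft b) fun x => traceSign (x * g)).symm
  simp_rw [add_mul, traceSign_add, ← Finset.mul_sum] at h
  rw [traceSign_eq_neg_one (by rwa [mul_comm])] at h
  linarith

omit [Algebra (ZMod 2) F] in
theorem card_pow_eq_one_units {n : ℕ} (hn : n ∣ Fintype.card F - 1) [DecidableEq F] :
    (Finset.univ.filter fun x : Fˣ => x ^ n = 1).card = n := by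
  have h := IsCyclic.card_powMonoidHom_ker Fˣ n
  rw [Nat.card_eq_fintype_card, Nat.card_eq_fintype_card, Fintype.card_units,
    Nat.gcd_eq_right hn] at h
  conv_rhs => rw [← h]
  rw [Fintype.card_subtype]
  congr 1
  ext x
  simp [MonoidHom.mem_ker]

omit [Algebra (ZMod 2) F] in
theorem card_pow_eq_self [DecidableEq F] {q : ℕ} (hF : Fintype.card F = q ^ 2) (hq : 2 ≤ q) :
    (Finset.univ.filter fun x : F => x ^ q = x).card = q := by
  have h := card_pow_eq_one_units (F := F) (n := q - 1) (by
    rw [hF]; exact ⟨q + 1, by zify [show 1 ≤ q by omega, Nat.one_le_pow 2 q (by omega)]; ring⟩)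
  have : (Finset.univ.filter fun x : F => x ^ q = x) =
      insert 0 ((Finset.univ.filter fun x : Fˣ => x ^ (q - 1) = 1).image Units.val) := by
    ext x
    simp only [Finset.mem_filter, Finset.mem_univ, true_and, Finset.mem_insert, Finset.mem_image]
    constructor
    · intro hx
      by_cases h0 : x = 0
      · exact Or.inl h0
      · refine Or.inr ⟨Units.mk0 x h0, ?_, rfl⟩
        ext
        push_cast
        apply mul_right_cancel₀ h0
        rw [Units.val_mk0, ← pow_succ, Nat.sub_add_cancel (by omega), hx, one_mul]
    · rintro (rfl | ⟨u, hu, rfl⟩)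
      · exact zero_pow (by omega)
      · have := congrArg (fun z : Fˣ => (z : F)) hu
        push_cast at this
        calc (u : F) ^ q = (u : F) ^ (q - 1) * u := by rw [← pow_succ, Nat.sub_add_cancel (by omega)]
          _ = u := by rw [this, one_mul]
  rw [this, Finset.card_insert_of_notMem (by simp), Finset.card_image_of_injective _ Units.val_injective, h]
  omega

/-- Among the 2m Frobenius conjugates in the trace, the last m repeat the first m, and the two
halves cancel. -/
theorem trace_eq_zero_of_pow_eq_self {m : ℕ} (hF : Fintype.card F = 2 ^ (2 * m)) {x : F}
    (hx : x ^ 2 ^ m = x) : Algebra.trace (ZMod 2) F x = 0 := by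
  have hfr : Module.finrank (ZMod 2) F = m + m := by
    have := Module.card_eq_pow_finrank (K := ZMod 2) (V := F)
    rw [hF, ZMod.card] at this
    have := Nat.pow_right_injective le_rfl this
    omega
  have : CharP F 2 := charP_of_injective_algebraMap (algebraMap (ZMod 2) F).injective 2
  apply (algebraMap (ZMod 2) F).injective
  rw [FiniteField.algebraMap_trace_eq_sum_pow, hfr, Finset.sum_range_add, map_zero]
  simp only [Nat.card_eq_fintype_card, ZMod.card, pow_add, pow_mul, hx]
  exact CharTwo.add_self_eq_zero _

/-- All these sums are nonnegative and total q² over g. The q elements g of the subfield contribute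
q each, leaving nothing for the others. -/
theorem sum_subfield_traceSign [DecidableEq F] {m : ℕ} (hm : 1 ≤ m)
    (hF : Fintype.card F = 2 ^ (2 * m)) (g : F) :
    ∑ y ∈ Finset.univ.filter (fun x : F => x ^ 2 ^ m = x), traceSign (y * g) =
      if g ^ 2 ^ m = g then 2 ^ m else 0 := by
  have : CharP F 2 := charP_of_injective_algebraMap (algebraMap (ZMod 2) F).injective 2
  set K := Finset.univ.filter (fun x : F => x ^ 2 ^ m = x) with hK
  have hF' : Fintype.card F = (2 ^ m) ^ 2 := by rw [hF, ← pow_mul, mul_comm]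
  have hq : 2 ≤ 2 ^ m := by
    calc 2 = 2 ^ 1 := rfl
      _ ≤ 2 ^ m := Nat.pow_le_pow_right (by norm_num) hm
  have hKc : K.card = 2 ^ m := card_pow_eq_self hF' hq
  have hmem (y : F) : y ∈ K ↔ y ^ 2 ^ m = y := by simp [hK]
  have hin (g : F) (hg : g ∈ K) : ∑ y ∈ K, traceSign (y * g) = 2 ^ m := by
    have : ∀ y ∈ K, traceSign (y * g) = 1 := by
      intro y hy
      rw [hmem] at hg hy
      rw [traceSign, trace_eq_zero_of_pow_eq_self hF (by rw [mul_pow, hg, hy])]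
      simp
    rw [Finset.sum_congr rfl this]
    simp [hKc]
  have hnonneg (g : F) : 0 ≤ ∑ y ∈ K, traceSign (y * g) := by
    by_cases h : ∃ y ∈ K, Algebra.trace (ZMod 2) F (y * g) ≠ 0
    · obtain ⟨b, hb, hbt⟩ := h
      have h : ∑ y ∈ K, traceSign (y * g) = ∑ y ∈ K, traceSign ((b + y) * g) := by
        symm
        apply Finset.sum_bij (fun y _ => b + y)
        · intro y hy
          rw [hmem] at *
          rw [add_pow_char_pow, hb, hy]
        · intro y _ z _ h; exact add_left_cancel h
        · intro y hy
          refine ⟨y - b, ?_, by ring⟩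
          rw [hmem] at *
          rw [sub_pow_char_pow, hb, hy]
        · intros; rfl
      simp_rw [add_mul, traceSign_add, ← Finset.mul_sum] at h
      rw [traceSign_eq_neg_one hbt] at h
      linarith
    · push Not at h
      apply Finset.sum_nonneg
      intro y hy
      simp [traceSign, h y hy]
  have htot : ∑ g : F, ∑ y ∈ K, traceSign (y * g) = 2 ^ m * 2 ^ m := by
    rw [Finset.sum_comm, Finset.sum_eq_single_of_mem 0 (by simp [hmem])]
    · simp [hF, two_mul, pow_add]
    · intro y _ hy
      simp_rw [mul_comm y]
      exact sum_traceSign_mul hy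
  have hsub : ∑ g ∈ K, ∑ y ∈ K, traceSign (y * g) = 2 ^ m * 2 ^ m := by
    rw [Finset.sum_congr rfl hin]; simp [hKc]
  have hcompl : ∑ g ∈ Kᶜ, ∑ y ∈ K, traceSign (y * g) = 0 := by
    have := Finset.sum_add_sum_compl K (fun g => ∑ y ∈ K, traceSign (y * g))
    linarith
  rw [Finset.sum_eq_zero_iff_of_nonneg (fun g _ => hnonneg g)] at hcompl
  split_ifs with h
  · exact hin g ((hmem g).2 h)
  · exact hcompl g (by simpa [hmem] using h)

end TraceSign

/-! ### Fibres of power maps on the unit group. -/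

section PowerImage

variable {F : Type*} [Field F] [Fintype F] [DecidableEq F]

/-- The nonzero `e`-th powers. -/
def unitPowers (F : Type*) [Field F] [Fintype F] [DecidableEq F] (e : ℕ) : Finset F :=
  Finset.univ.image fun x : Fˣ => (x : F) ^ e

theorem card_filter_unit_pow (e : ℕ) (p : F → Prop) [DecidablePred p] :
    (Finset.univ.filter fun x : Fˣ => p ((x : F) ^ e)).card =
      (Fintype.card F - 1).gcd e * ((unitPowers F e).filter p).card := by
  rw [Finset.card_eq_sum_card_fiberwise (f := fun x : Fˣ => (x : F) ^ e)
    (t := (unitPowers F e).filter p)]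
  · rw [mul_comm, ← smul_eq_mul]
    apply Finset.sum_const_nat
    intro v hv
    obtain ⟨hv, hp⟩ := Finset.mem_filter.1 hv
    obtain ⟨y, -, rfl⟩ := Finset.mem_image.1 hv
    have h1 : ((Finset.univ.filter fun x : Fˣ => p ((x : F) ^ e)).filter
        fun x : Fˣ => (x : F) ^ e = (y : F) ^ e) =
        (Finset.univ.filter fun x : Fˣ => powMonoidHom e x = powMonoidHom e y : Finset Fˣ) := by
      ext x
      simp only [Finset.mem_filter, Finset.mem_univ, true_and, powMonoidHom_apply, Units.ext_iff,
        Units.val_pow_eq_pow_val, and_iff_right_iff_imp]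
      intro h; rwa [h]
    rw [h1, MonoidHom.card_fiber_eq_of_mem_range (powMonoidHom e : Fˣ →* Fˣ) ⟨y, rfl⟩
      ⟨1, map_one _⟩]
    have h := IsCyclic.card_powMonoidHom_ker Fˣ e
    rw [Nat.card_eq_fintype_card, Nat.card_eq_fintype_card, Fintype.card_units] at h
    rw [← h, Fintype.card_subtype]
    congr 1
    ext x
    simp [MonoidHom.mem_ker]
  · intro x hx
    simp only [Finset.coe_filter, Finset.mem_univ, true_and, Set.mem_ofPred_eq] at hx ⊢
    exact ⟨Finset.mem_image_of_mem _ (Finset.mem_univ x), hx⟩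

theorem gcd_mul_card_unitPowers (e : ℕ) :
    (Fintype.card F - 1).gcd e * (unitPowers F e).card = Fintype.card F - 1 := by
  have := card_filter_unit_pow (F := F) e (fun _ => True)
  simp only [Finset.filter_true, Finset.card_univ, Fintype.card_units] at this
  exact this.symm

end PowerImage

/-! ### From the exponential sum to a count of zeros. -/

section Reduction

variable {F : Type*} [Field F] [Fintype F] [Algebra (ZMod 2) F] [DecidableEq F]

omit [Fintype F] [Algebra (ZMod 2) F] [DecidableEq F] in
theorem pow_mul_sub_one_add_one {y : F} {q : ℕ} (hq : 1 ≤ q) (hy : y ^ q = y) (s : ℕ) :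
    y ^ (s * (q - 1) + 1) = y := by
  induction s with
  | zero => simp
  | succ s ih =>
    have : (s + 1) * (q - 1) + 1 = s * (q - 1) + q := by
      rw [add_mul]; omega
    rw [this, pow_add, hy, ← pow_succ, ih]

omit [DecidableEq F] in
-- With z = x^(q-1) one has x^dᵢ = z^sᵢ x and z^q = 1/z. Multiplying h(x)^q - h(x) by z^(s₂-1)/x
-- leaves only powers of z^t, because s₁ + s₂ - 1 = 2^k t and 2s₂ - 1 = (2^k + 1)t.
theorem pow_mul_eq_self_iff {m k t s₁ s₂ : ℕ} (hF : Fintype.card F = 2 ^ (2 * m))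
    (h12 : s₂ = s₁ + t) (h22 : 2 * s₂ = (2 ^ k + 1) * t + 1) (hs₁ : 1 ≤ s₁)
    (a b : F) (x : Fˣ) :
    (a * (x : F) ^ (s₁ * (2 ^ m - 1) + 1) + b * (x : F) ^ (s₂ * (2 ^ m - 1) + 1)) ^ 2 ^ m =
        a * (x : F) ^ (s₁ * (2 ^ m - 1) + 1) + b * (x : F) ^ (s₂ * (2 ^ m - 1) + 1) ↔
      niho (2 ^ m) (2 ^ k) ((x : F) ^ ((2 ^ m - 1) * t)) (a, b) = 0 := by
  have : CharP F 2 := charP_of_injective_algebraMap (algebraMap (ZMod 2) F).injective 2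
  have h2 : (2 : F) = 0 := CharTwo.two_eq_zero
  have hx0 : (x : F) ≠ 0 := x.ne_zero
  set X : F := (x : F) with hX
  set z : F := X ^ (2 ^ m - 1) with hz
  have hz0 : z ≠ 0 := pow_ne_zero _ hx0
  have hq : 1 ≤ 2 ^ m := Nat.one_le_two_pow
  have hXz : X ^ 2 ^ m = z * X := by rw [hz, ← pow_succ, Nat.sub_add_cancel hq]
  have hzz : z ^ 2 ^ m * z = 1 := by
    rw [← pow_succ, hz, ← pow_mul]
    have : (2 ^ m - 1) * (2 ^ m + 1) = Fintype.card F - 1 := by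
      rw [hF, two_mul, pow_add]
      zify [hq, Nat.one_le_iff_ne_zero.2 (show 2 ^ m * 2 ^ m ≠ 0 by positivity)]
      ring
    rw [this, FiniteField.pow_card_sub_one_eq_one _ hx0]
  obtain ⟨r, rfl⟩ : ∃ r, s₁ = r + 1 := ⟨s₁ - 1, by omega⟩
  have e1 : X ^ ((r + 1) * (2 ^ m - 1) + 1) = z ^ (r + 1) * X := by
    rw [pow_succ, mul_comm (r + 1), pow_mul]
  have e2 : X ^ (s₂ * (2 ^ m - 1) + 1) = z ^ s₂ * X := by
    rw [pow_succ, mul_comm s₂, pow_mul]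
  have e3 : X ^ ((2 ^ m - 1) * t) = z ^ t := pow_mul _ _ _
  have e4 : r + t + (r + t + 1) = t * (2 ^ k + 1) := by
    subst h12; linarith
  have e5 : r + (r + t + 1) = t * 2 ^ k := by
    rw [mul_add] at e4; omega
  rw [e1, e2, e3, add_pow_char_pow]
  subst h12
  simp only [niho]
  rw [← pow_mul z t, ← pow_mul z t, ← e4, ← e5, mul_pow, mul_pow, mul_pow, mul_pow, hXz]
  have hc1 : (z ^ (r + 1)) ^ 2 ^ m * z ^ (r + 1) = 1 := by
    rw [pow_right_comm, ← mul_pow, hzz, one_pow]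
  have hc2 : (z ^ (r + 1 + t)) ^ 2 ^ m * z ^ (r + 1 + t) = 1 := by
    rw [pow_right_comm, ← mul_pow, hzz, one_pow]
  have key : b * z ^ (r + t + (r + t + 1)) + a * z ^ (r + (r + t + 1)) + a ^ 2 ^ m * z ^ t
      + b ^ 2 ^ m = z ^ (r + t) * X⁻¹ * (
        (a ^ 2 ^ m * ((z ^ (r + 1)) ^ 2 ^ m * (z * X)) +
          b ^ 2 ^ m * ((z ^ (r + 1 + t)) ^ 2 ^ m * (z * X))) -
        (a * (z ^ (r + 1) * X) + b * (z ^ (r + 1 + t) * X))) := by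
    have hXX : X⁻¹ * X = 1 := inv_mul_cancel₀ hx0
    have f1 : z ^ (r + t) * (z ^ (r + 1)) ^ 2 ^ m * z = z ^ t := by
      calc _ = (z ^ (r + 1)) ^ 2 ^ m * z ^ (r + 1) * z ^ t := by ring
        _ = _ := by rw [hc1, one_mul]
    have f2 : z ^ (r + t) * (z ^ (r + 1 + t)) ^ 2 ^ m * z = 1 := by
      calc _ = (z ^ (r + 1 + t)) ^ 2 ^ m * z ^ (r + 1 + t) := by ring
        _ = _ := hc2
    have f3 : z ^ (r + t) * z ^ (r + 1) = z ^ (r + (r + t + 1)) := by ring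
    have f4 : z ^ (r + t) * z ^ (r + 1 + t) = z ^ (r + t + (r + t + 1)) := by ring
    linear_combination (a * z ^ (r + (r + t + 1)) + b * z ^ (r + t + (r + t + 1))) * h2
      - (a ^ 2 ^ m * f1 + b ^ 2 ^ m * f2 - a * f3 - b * f4) - 
      (a ^ 2 ^ m * (z ^ (r + t) * (z ^ (r + 1)) ^ 2 ^ m * z) +
        b ^ 2 ^ m * (z ^ (r + t) * (z ^ (r + 1 + t)) ^ 2 ^ m * z) - 
        a * (z ^ (r + t) * z ^ (r + 1)) - b * (z ^ (r + t) * z ^ (r + 1 + t))) * hXX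
  rw [key, mul_eq_zero, sub_eq_zero, or_iff_right]
  exact mul_ne_zero (pow_ne_zero _ hz0) (inv_ne_zero hx0)

theorem binaryExpSum_eq {m k t s₁ s₂ : ℕ} (hm : 1 ≤ m) (hF : Fintype.card F = 2 ^ (2 * m))
    (h12 : s₂ = s₁ + t) (h22 : 2 * s₂ = (2 ^ k + 1) * t + 1) (hs₁ : 1 ≤ s₁) (a b : F) :
    binaryExpSum F (s₁ * (2 ^ m - 1) + 1) (s₂ * (2 ^ m - 1) + 1) a b =
      ((t.gcd (2 ^ m + 1) : ℤ) * (((unitPowers F ((2 ^ m - 1) * t)).filter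
        fun v => niho (2 ^ m) (2 ^ k) v (a, b) = 0).card : ℤ) - 1) * 2 ^ m := by
  have hq : 2 ≤ 2 ^ m := by
    calc 2 = 2 ^ 1 := rfl
      _ ≤ 2 ^ m := Nat.pow_le_pow_right (by norm_num) hm
  have hF' : Fintype.card F = (2 ^ m) ^ 2 := by rw [hF, ← pow_mul, mul_comm]
  set h : F → F := fun x => a * x ^ (s₁ * (2 ^ m - 1) + 1) + b * x ^ (s₂ * (2 ^ m - 1) + 1)
    with hh
  set K := Finset.univ.filter (fun x : F => x ^ 2 ^ m = x) with hK
  set T := binaryExpSum F (s₁ * (2 ^ m - 1) + 1) (s₂ * (2 ^ m - 1) + 1) a b with hT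
  have hKc : K.card = 2 ^ m := card_pow_eq_self hF' hq
  have h0K : (0 : F) ∈ K := by simp [hK]
  have hscale (y x : F) (hy : y ∈ K) : h (y * x) = y * h x := by
    have hy : y ^ 2 ^ m = y := by simpa [hK] using hy
    simp only [hh, mul_pow, pow_mul_sub_one_add_one (by omega : 1 ≤ 2 ^ m) hy]
    ring
  have hTy (y : F) (hy : y ∈ K.erase 0) : ∑ x : F, traceSign (y * h x) = T := by
    obtain ⟨hy0, hyK⟩ := Finset.mem_erase.1 hy
    simp_rw [← hscale y _ hyK]
    exact Equiv.sum_comp (Equiv.mulLeft₀ y hy0) fun x => traceSign (h x)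
  have hcount : (Finset.univ.filter fun x : F => h x ^ 2 ^ m = h x).card =
      1 + (2 ^ m - 1) * t.gcd (2 ^ m + 1) * ((unitPowers F ((2 ^ m - 1) * t)).filter
        fun v => niho (2 ^ m) (2 ^ k) v (a, b) = 0).card := by
    have hgcd : (Fintype.card F - 1).gcd ((2 ^ m - 1) * t) =
        (2 ^ m - 1) * t.gcd (2 ^ m + 1) := by
      have : Fintype.card F - 1 = (2 ^ m - 1) * (2 ^ m + 1) := by
        rw [hF']
        zify [show 1 ≤ 2 ^ m by omega, Nat.one_le_iff_ne_zero.2 (show (2 ^ m) ^ 2 ≠ 0 by positivity)]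
        ring
      rw [this, Nat.gcd_mul_left, Nat.gcd_comm]
    rw [← hgcd, ← card_filter_unit_pow]
    have hins : (Finset.univ.filter fun x : F => h x ^ 2 ^ m = h x) = insert 0
        ((Finset.univ.filter fun x : Fˣ =>
          niho (2 ^ m) (2 ^ k) ((x : F) ^ ((2 ^ m - 1) * t)) (a, b) = 0).image Units.val) := by
      ext x
      simp only [Finset.mem_filter, Finset.mem_univ, true_and, Finset.mem_insert,
        Finset.mem_image]
      constructor
      · intro hx
        by_cases h0 : x = 0
        · exact Or.inl h0
        · exact Or.inr ⟨Units.mk0 x h0,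
            (pow_mul_eq_self_iff hF h12 h22 hs₁ a b (Units.mk0 x h0)).1 hx, rfl⟩
      · rintro (rfl | ⟨u, hu, rfl⟩)
        · simp [hh]
        · exact (pow_mul_eq_self_iff hF h12 h22 hs₁ a b u).2 hu
    rw [hins, Finset.card_insert_of_notMem (by simp),
      Finset.card_image_of_injective _ Units.val_injective, add_comm]
  -- Double count of the character of y h(x) over y in K and x in F: y = 0 gives q² and every other
  -- y gives T, while for fixed x the sum over y detects h(x) ∈ K.
  have hmain : (2 ^ m - 1 : ℤ) * T + (2 ^ m) ^ 2 =
      2 ^ m * (1 + (2 ^ m - 1) * t.gcd (2 ^ m + 1) *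
        ((unitPowers F ((2 ^ m - 1) * t)).filter
          fun v => niho (2 ^ m) (2 ^ k) v (a, b) = 0).card) := by
    have hl : ∑ y ∈ K, ∑ x : F, traceSign (y * h x) = (2 ^ m - 1 : ℤ) * T + (2 ^ m) ^ 2 := by
      rw [← Finset.sum_erase_add _ _ h0K, Finset.sum_congr rfl hTy, Finset.sum_const,
        Finset.card_erase_of_mem h0K, hKc, nsmul_eq_mul, Nat.cast_sub (by omega)]
      simp [hF']
    rw [← hl, Finset.sum_comm]
    simp_rw [hK, sum_subfield_traceSign hm hF]
    rw [← Finset.sum_filter, Finset.sum_const, hcount, nsmul_eq_mul]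
    push_cast [show 1 ≤ 2 ^ m by omega]
    ring
  have hne : (2 ^ m - 1 : ℤ) ≠ 0 := by
    have : (2 : ℤ) ≤ 2 ^ m := by exact_mod_cast hq
    linarith
  apply mul_left_cancel₀ hne
  linear_combination hmain

end Reduction

/-! ### Independence of the conditions and binomial moments. -/

section Moments

variable {F : Type*} [Field F] [Fintype F] [DecidableEq F]

/-- The coefficient pairs whose condition holds at every point of `S`. -/
def nihoKernel (q r : ℕ) (S : Finset F) : Finset (F × F) :=
  Finset.univ.filter fun ab => ∀ v ∈ S, niho q r v ab = 0

theorem mem_nihoKernel {q r : ℕ} {S : Finset F} {ab : F × F} :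
    ab ∈ nihoKernel q r S ↔ ∀ v ∈ S, niho q r v ab = 0 := by
  simp [nihoKernel]

omit [Fintype F] [DecidableEq F] in
theorem niho_sub [CharP F 2] (m r : ℕ) (v : F) (x y : F × F) :
    niho (2 ^ m) r v (x - y) = niho (2 ^ m) r v x - niho (2 ^ m) r v y := by
  simp only [niho, Prod.fst_sub, Prod.snd_sub, pow_two_pow_sub]
  ring

theorem card_pow_mul_eq_self_le {q : ℕ} (hF : Fintype.card F = q ^ 2) (hq : 2 ≤ q) (c : F) :
    (Finset.univ.filter fun y : F => y ^ q * c = y).card ≤ q := by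
  by_cases h : ∃ y : F, y ^ q * c = y ∧ y ≠ 0
  · obtain ⟨z, hz, hz0⟩ := h
    refine le_of_le_of_eq ?_ (card_pow_eq_self hF hq)
    apply Finset.card_le_card_of_injOn (fun y => y / z)
    · intro y hy
      simp only [Finset.coe_filter, Finset.mem_univ, true_and, Set.mem_ofPred_eq] at hy ⊢
      have hc : c ≠ 0 := by rintro rfl; exact hz0 (by simpa using hz.symm)
      rw [div_pow, ← mul_div_mul_right _ _ hc, hy, hz]
    · intro y _ y' _ h
      exact (div_left_inj' hz0).1 h
  · push Not at h
    calc _ ≤ ({0} : Finset F).card := by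
          apply Finset.card_le_card
          intro y hy
          exact Finset.mem_singleton.2 (h y (by simpa using hy))
      _ ≤ q := by simp; omega

omit [DecidableEq F] in
-- The polynomial is self-reciprocal under conjugation. Its value at v is thus confined to at most q
-- elements, which is why a point costs a factor q and not q².
theorem niho_pow_mul [CharP F 2] {m : ℕ} (hF : Fintype.card F = (2 ^ m) ^ 2) (r : ℕ) {v : F}
    (hv : v ^ (2 ^ m + 1) = 1) (ab : F × F) :
    niho (2 ^ m) r v ab ^ 2 ^ m * v ^ (r + 1) = niho (2 ^ m) r v ab := by
  have hpow (x : F) : (x ^ 2 ^ m) ^ 2 ^ m = x := by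
    rw [← pow_mul, ← sq, ← hF, FiniteField.pow_card]
  simp only [niho, add_pow_char_pow, mul_pow, hpow]
  have h1 : (v ^ (r + 1)) ^ 2 ^ m * v ^ (r + 1) = 1 := by
    rw [← pow_succ, pow_right_comm, hv, one_pow]
  have h2 : (v ^ r) ^ 2 ^ m * v ^ r = 1 := by
    rw [← pow_succ, pow_right_comm, hv, one_pow]
  have h3 : v ^ 2 ^ m * v = 1 := by rw [← pow_succ, hv]
  have h4 : v ^ (r + 1) = v ^ r * v := pow_succ _ _
  linear_combination ab.2 ^ 2 ^ m * h1 + ab.1 ^ 2 ^ m * v * h2 + ab.1 * v ^ r * h3 +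
    ab.1 ^ 2 ^ m * (v ^ r) ^ 2 ^ m * h4 + ab.1 * v ^ 2 ^ m * h4

theorem card_nihoKernel_le_insert [CharP F 2] {m : ℕ} (hm : 1 ≤ m)
    (hF : Fintype.card F = (2 ^ m) ^ 2) (r : ℕ) (S : Finset F) {v : F}
    (hv : v ^ (2 ^ m + 1) = 1) :
    (nihoKernel (2 ^ m) r S).card ≤ 2 ^ m * (nihoKernel (2 ^ m) r (insert v S)).card := by
  have hq : 2 ≤ 2 ^ m := by
    calc 2 = 2 ^ 1 := rfl
      _ ≤ 2 ^ m := Nat.pow_le_pow_right (by norm_num) hm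
  rw [mul_comm]
  refine (Finset.card_le_mul_card_image_of_maps_to (f := niho (2 ^ m) r v)
    (t := Finset.univ.filter fun y : F => y ^ 2 ^ m * v ^ (r + 1) = y) ?_
    (nihoKernel (2 ^ m) r (insert v S)).card ?_).trans
    (Nat.mul_le_mul_left _ (card_pow_mul_eq_self_le hF hq _))
  · intro ab _
    simpa using niho_pow_mul hF r hv ab
  · intro y _
    rcases Finset.eq_empty_or_nonempty
      ((nihoKernel (2 ^ m) r S).filter fun ab => niho (2 ^ m) r v ab = y) with h | ⟨p, hp⟩
    · rw [h]; simp
    · apply Finset.card_le_card_of_injOn (fun ab => ab - p)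
      · intro ab hab
        simp only [Finset.coe_filter, Set.mem_ofPred_eq, Finset.mem_filter,
          Finset.mem_coe, mem_nihoKernel, Finset.mem_insert] at hab hp ⊢
        rintro w (rfl | hw)
        · rw [niho_sub, hab.2, hp.2, sub_self]
        · rw [niho_sub, hab.1 w hw, hp.1 w hw, sub_self]
      · intro x _ y _ h
        exact sub_left_injective h

theorem card_nihoKernel_le_union [CharP F 2] {m : ℕ} (hm : 1 ≤ m)
    (hF : Fintype.card F = (2 ^ m) ^ 2) (r : ℕ) (S R : Finset F)
    (hR : ∀ v ∈ R, v ^ (2 ^ m + 1) = 1) :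
    (nihoKernel (2 ^ m) r S).card ≤
      (2 ^ m) ^ R.card * (nihoKernel (2 ^ m) r (R ∪ S)).card := by
  induction R using Finset.induction_on with
  | empty => simp
  | insert v R hvR ih =>
    refine (ih fun w hw => hR w (Finset.mem_insert_of_mem hw)).trans ?_
    rw [Finset.card_insert_of_notMem hvR, Finset.insert_union, pow_succ, mul_assoc]
    exact Nat.mul_le_mul_left _
      (card_nihoKernel_le_insert hm hF r _ (hR v (Finset.mem_insert_self _ _)))

theorem nihoKernel_eq_of_card_eq_four [CharP F 2] {k m : ℕ} (hkm : k.Coprime m)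
    {S : Finset F} (hS : S.card = 4) (hunit : ∀ v ∈ S, v ^ (2 ^ m + 1) = 1) :
    nihoKernel (2 ^ m) (2 ^ k) S = {0} := by
  ext ⟨a, b⟩
  rw [mem_nihoKernel, Finset.mem_singleton]
  constructor
  · intro h
    let e := S.equivFinOfCardEq hS
    obtain ⟨ha, hb⟩ := eq_zero_of_niho_eq_zero hkm (v := fun i => (e.symm i : F))
      (Subtype.val_injective.comp e.symm.injective)
      (fun i => hunit _ (e.symm i).2) (fun i => h _ (e.symm i).2)
    rw [ha, hb]; rfl
  · rintro h v -
    rw [h]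
    simp [niho]

/-- A squeeze: extending S to four points, where the kernel is trivial, gives the upper bound, and
building S up from the empty set gives the lower one. -/
theorem card_nihoKernel [CharP F 2] {k m : ℕ} (hm : 1 ≤ m)
    (hF : Fintype.card F = (2 ^ m) ^ 2) (hkm : k.Coprime m) {V : Finset F}
    (hV : 4 ≤ V.card) (hunit : ∀ v ∈ V, v ^ (2 ^ m + 1) = 1) {S : Finset F} (hSV : S ⊆ V)
    (hS : S.card ≤ 4) :
    (nihoKernel (2 ^ m) (2 ^ k) S).card = (2 ^ m) ^ (4 - S.card) := by
  have hq : 0 < 2 ^ m := by positivity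
  apply le_antisymm
  · obtain ⟨S', hSS', hS'V, hS'⟩ := Finset.exists_subsuperset_card_eq hSV hS hV
    have h := card_nihoKernel_le_union hm hF (2 ^ k) S (S' \ S)
      (fun v hv => hunit v (hS'V (Finset.mem_sdiff.1 hv).1))
    rw [Finset.sdiff_union_of_subset hSS', Finset.card_sdiff_of_subset hSS', hS',
      nihoKernel_eq_of_card_eq_four hkm hS' (fun v hv => hunit v (hS'V hv))] at h
    simpa using h
  · have h := card_nihoKernel_le_union hm hF (2 ^ k) ∅ S (fun v hv => hunit v (hSV hv))
    have h0 : (nihoKernel (2 ^ m) (2 ^ k) (∅ : Finset F)).card = (2 ^ m) ^ 4 := by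
      have : nihoKernel (2 ^ m) (2 ^ k) (∅ : Finset F) = Finset.univ := by
        ext; simp [mem_nihoKernel]
      rw [this, Finset.card_univ, Fintype.card_prod, hF]; ring
    rw [h0, Finset.union_empty] at h
    have h4 : (2 ^ m) ^ 4 = (2 ^ m) ^ S.card * (2 ^ m) ^ (4 - S.card) := by
      rw [← pow_add]; congr 1; omega
    rw [h4] at h
    exact Nat.le_of_mul_le_mul_left h (by positivity)

/-- The number of points of `V` at which the condition with coefficients `ab` holds. -/
def nihoCount (q r : ℕ) (V : Finset F) (ab : F × F) : ℕ :=
  (V.filter fun v => niho q r v ab = 0).card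

/-- Double count of the pairs (ab, S) with S a j-subset of the zeros of ab in V. -/
theorem sum_choose_nihoCount [CharP F 2] {k m : ℕ} (hm : 1 ≤ m)
    (hF : Fintype.card F = (2 ^ m) ^ 2) (hkm : k.Coprime m) {V : Finset F}
    (hV : 4 ≤ V.card) (hunit : ∀ v ∈ V, v ^ (2 ^ m + 1) = 1) {j : ℕ} (hj : j ≤ 4) :
    ∑ ab, (nihoCount (2 ^ m) (2 ^ k) V ab).choose j = V.card.choose j * (2 ^ m) ^ (4 - j) := by
  have h1 (ab : F × F) : (nihoCount (2 ^ m) (2 ^ k) V ab).choose j =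
      ∑ S ∈ V.powersetCard j, if ab ∈ nihoKernel (2 ^ m) (2 ^ k) S then 1 else 0 := by
    rw [nihoCount, ← Finset.card_powersetCard, ← Finset.sum_filter, ← Finset.card_eq_sum_ones]
    congr 1
    ext S
    simp only [Finset.mem_powersetCard, Finset.mem_filter, mem_nihoKernel,
      Finset.subset_iff]
    constructor
    · rintro ⟨h, hc⟩
      exact ⟨⟨fun v hv => (h hv).1, hc⟩, fun v hv => (h hv).2⟩
    · rintro ⟨⟨h, hc⟩, h'⟩
      exact ⟨fun v hv => ⟨h hv, h' v hv⟩, hc⟩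
  simp_rw [h1]
  rw [Finset.sum_comm, ← Finset.card_powersetCard]
  apply Finset.sum_const_nat
  intro S hS
  obtain ⟨hSV, hSc⟩ := Finset.mem_powersetCard.1 hS
  rw [← Finset.sum_filter, ← Finset.card_eq_sum_ones, Finset.filter_mem_eq_inter,
    Finset.univ_inter, card_nihoKernel hm hF hkm hV hunit hSV (hSc ▸ hj), hSc]

omit [Fintype F] in
theorem nihoCount_zero {m r : ℕ} (V : Finset F) : nihoCount (2 ^ m) r V 0 = V.card := by
  simp [nihoCount, niho]

theorem nihoCount_lt_four [CharP F 2] {k m : ℕ} (hkm : k.Coprime m) {V : Finset F}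
    (hunit : ∀ v ∈ V, v ^ (2 ^ m + 1) = 1) {ab : F × F} (hab : ab ≠ 0) :
    nihoCount (2 ^ m) (2 ^ k) V ab < 4 := by
  by_contra! h
  obtain ⟨S, hS, hSc⟩ := Finset.exists_subset_card_eq h
  have := nihoKernel_eq_of_card_eq_four hkm hSc
    (fun v hv => hunit v (Finset.mem_filter.1 (hS hv)).1)
  apply hab
  rw [← Finset.mem_singleton, ← this, mem_nihoKernel]
  exact fun v hv => (Finset.mem_filter.1 (hS hv)).2

theorem sum_nihoCount_eq [CharP F 2] {k m : ℕ} (hkm : k.Coprime m) {V : Finset F}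
    (hV : 4 ≤ V.card) (hunit : ∀ v ∈ V, v ^ (2 ^ m + 1) = 1) (f : ℕ → ℕ) :
    ∑ ab, f (nihoCount (2 ^ m) (2 ^ k) V ab) = f V.card + ∑ i ∈ Finset.range 4,
      (Finset.univ.filter fun ab => nihoCount (2 ^ m) (2 ^ k) V ab = i).card * f i := by
  rw [← Finset.add_sum_erase _ _ (Finset.mem_univ (0 : F × F)), nihoCount_zero,
    ← Finset.sum_fiberwise_of_maps_to (s := Finset.univ.erase (0 : F × F))
      (t := Finset.range 4) (g := nihoCount (2 ^ m) (2 ^ k) V)]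
  · congr 1
    apply Finset.sum_congr rfl
    intro i hi
    have : (Finset.univ.erase (0 : F × F)).filter
        (fun ab => nihoCount (2 ^ m) (2 ^ k) V ab = i) =
        Finset.univ.filter fun ab => nihoCount (2 ^ m) (2 ^ k) V ab = i := by
      rw [Finset.filter_erase, Finset.erase_eq_of_notMem]
      rw [Finset.mem_filter, nihoCount_zero]
      have := Finset.mem_range.1 hi
      omega
    rw [this]
    apply Finset.sum_const_nat
    intro ab hab
    rw [(Finset.mem_filter.1 hab).2]
  · intro ab hab
    exact Finset.mem_range.2 (nihoCount_lt_four hkm hunit (Finset.mem_erase.1 hab).1)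

end Moments

/-! ### Arithmetic of M and the final inversion. -/

section Frequencies

/-- M is odd, so only 1 and 3 need excluding. For M = 3, the prime 3 divides 4^k - 1 and hence one
of 2^k ± 1, contradicting one of the two non-congruences. -/
theorem five_le_of_mul_eq {m k t l M : ℕ} (hm : 1 ≤ m) (hlt : l ∣ t)
    (hlM : l * M = 2 ^ m + 1)
    (hminus : ¬ ((2 ^ k - 1) * t ≡ 0 [MOD 2 ^ m + 1]))
    (hplus : ¬ ((2 ^ k + 1) * t ≡ 0 [MOD 2 ^ m + 1])) : 5 ≤ M := by
  rw [Nat.modEq_zero_iff_dvd] at hminus hplus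
  have hodd : Odd M := by
    have : Odd (l * M) := by
      rw [hlM]
      exact (Nat.even_pow.2 ⟨even_two, by omega⟩).add_one
    exact Nat.Odd.of_mul_right this
  by_contra! h
  obtain rfl | rfl : M = 1 ∨ M = 3 := by
    obtain ⟨r, rfl⟩ := hodd
    omega
  · rw [mul_one] at hlM
    exact hminus (hlM ▸ hlt.mul_left _)
  · have h3 : 3 ∣ (2 ^ k - 1) * (2 ^ k + 1) := by
      have h4 : (2 ^ k - 1) * (2 ^ k + 1) = 4 ^ k - 1 := by
        have : 4 ^ k = 2 ^ k * 2 ^ k := by rw [← mul_pow]; norm_num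
        rw [this]
        zify [Nat.one_le_two_pow (n := k),
          Nat.one_le_iff_ne_zero.2 (show 2 ^ k * 2 ^ k ≠ 0 by positivity)]
        ring
      rw [h4]
      exact Nat.sub_one_dvd_pow_sub_one 4 k
    rw [← hlM, mul_comm l] at hminus hplus
    rcases (Nat.Prime.dvd_mul Nat.prime_three).1 h3 with h | h
    · exact hminus (mul_dvd_mul h hlt)
    · exact hplus (mul_dvd_mul h hlt)

theorem coprime_of_modEq_neg_one {m k : ℕ}
    (h : (m : ℤ) ≡ -1 [ZMOD (k : ℤ)] ∨ Nat.gcd k (2 * m) = 1) : k.Coprime m := by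
  rcases h with h | h
  · rw [← Nat.isCoprime_iff_coprime]
    obtain ⟨c, hc⟩ := h.dvd
    exact ⟨-c, -1, by linarith⟩
  · exact Nat.Coprime.coprime_mul_left_right h

theorem cast_choose_three (M : ℕ) :
    (M.choose 3 : ℚ) = M * (M - 1) * (M - 2) / 6 := by
  induction M with
  | zero => simp
  | succ n ih =>
    rw [Nat.choose_succ_succ' n 2, Nat.cast_add, ih, Nat.cast_choose_two]
    push_cast
    ring

end Frequencies

/- `F` is the field with `2 ^ (2 * m)` elements. The natural number subtractions and divisions
below are exact, because `t` is odd and `k, m ≥ 1`. Frequencies are compared in `ℚ`. -/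
theorem theorem3 (F : Type*) [Field F] [Fintype F] [Algebra (ZMod 2) F]
    (m k t s₁ s₂ d₁ d₂ l : ℕ) (hm : 2 ≤ m) (hF : Fintype.card F = 2 ^ (2 * m))
    (hk1 : 1 ≤ k) (hkm : k ≤ m)
    (ht_odd : Odd t) (ht1 : 1 ≤ t) (ht2 : t ≤ 2 ^ m + 1)
    (hs₁ : s₁ = 2 ^ (k - 1) * t - (t - 1) / 2)
    (hs₂ : s₂ = 2 ^ (k - 1) * t + (t + 1) / 2)
    (hd₁ : d₁ = s₁ * (2 ^ m - 1) + 1)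
    (hd₂ : d₂ = s₂ * (2 ^ m - 1) + 1)
    (hminus : ¬ ((2 ^ k - 1) * t ≡ 0 [MOD 2 ^ m + 1]))
    (hplus : ¬ ((2 ^ k + 1) * t ≡ 0 [MOD 2 ^ m + 1]))
    (hl : l = Nat.gcd t (2 ^ m + 1))
    (hcond : (m : ℤ) ≡ -1 [ZMOD (k : ℤ)] ∨ Nat.gcd k (2 * m) = 1) :
    -- the trivial value, taken at `(0, 0)`
    binaryExpSum F d₁ d₂ 0 0 = 2 ^ (2 * m) ∧
    -- the nontrivial values
    (∀ a b : F, (a, b) ≠ (0, 0) →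
      binaryExpSum F d₁ d₂ a b = -2 ^ m ∨
      binaryExpSum F d₁ d₂ a b = ((l : ℤ) - 1) * 2 ^ m ∨
      binaryExpSum F d₁ d₂ a b = (2 * (l : ℤ) - 1) * 2 ^ m ∨
      binaryExpSum F d₁ d₂ a b = (3 * (l : ℤ) - 1) * 2 ^ m) ∧
    -- the frequencies
    valueFrequency F d₁ d₂ (2 ^ (2 * m)) = 1 ∧
    (valueFrequency F d₁ d₂ ((3 * (l : ℤ) - 1) * 2 ^ m) : ℚ) =
      ((2 ^ (2 * m) - 1) * (2 ^ m + 1 - 2 * (l : ℚ)) * (2 ^ m + 1 - (l : ℚ)))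
        / (6 * (l : ℚ) ^ 3) ∧
    (valueFrequency F d₁ d₂ ((2 * (l : ℤ) - 1) * 2 ^ m) : ℚ) =
      ((2 ^ (2 * m) - 1) * ((2 ^ m + 3) * (l : ℚ) - 2 ^ m - 1) * (2 ^ m + 1 - (l : ℚ)))
        / (2 * (l : ℚ) ^ 3) ∧
    (valueFrequency F d₁ d₂ (((l : ℤ) - 1) * 2 ^ m) : ℚ) =
      ((2 ^ (2 * m) - 1) *
        ((2 ^ (2 * m + 1) + 2 ^ (m + 2) + 6) * (l : ℚ) ^ 2
          - (2 ^ (2 * m + 1) + 7 * 2 ^ m + 5) * (l : ℚ) + (2 ^ m + 1) ^ 2))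
        / (2 * (l : ℚ) ^ 3) ∧
    (valueFrequency F d₁ d₂ (-2 ^ m) : ℚ) =
      ((2 ^ (2 * m) - 1) *
        (6 * (2 ^ (2 * m) + 1) * (l : ℚ) ^ 3
          - (6 * 2 ^ (2 * m) + 9 * 2 ^ m + 11) * (l : ℚ) ^ 2
          + (3 * 2 ^ (2 * m) + 9 * 2 ^ m + 6) * (l : ℚ) - (2 ^ m + 1) ^ 2))
        / (6 * (l : ℚ) ^ 3) := by
  classical
  have : CharP F 2 := charP_of_injective_algebraMap (algebraMap (ZMod 2) F).injective 2
  have hq2 : 2 ≤ 2 ^ m := by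
    calc 2 = 2 ^ 1 := rfl
      _ ≤ 2 ^ m := Nat.pow_le_pow_right (by norm_num) (by omega)
  have hF' : Fintype.card F = (2 ^ m) ^ 2 := by rw [hF, ← pow_mul, mul_comm]
  have hcard : Fintype.card F - 1 = (2 ^ m - 1) * (2 ^ m + 1) := by
    rw [hF']
    zify [show 1 ≤ 2 ^ m by omega, Nat.one_le_iff_ne_zero.2 (show (2 ^ m) ^ 2 ≠ 0 by positivity)]
    ring
  have hkm' : k.Coprime m := coprime_of_modEq_neg_one hcond
  set V := unitPowers F ((2 ^ m - 1) * t) with hVdef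
  have hlM : l * V.card = 2 ^ m + 1 := by
    have h := gcd_mul_card_unitPowers (F := F) ((2 ^ m - 1) * t)
    rw [hcard, Nat.gcd_mul_left, Nat.gcd_comm, ← hl, mul_assoc] at h
    exact Nat.eq_of_mul_eq_mul_left (by omega) h
  have hM : 5 ≤ V.card :=
    five_le_of_mul_eq (by omega) (hl ▸ Nat.gcd_dvd_left _ _) hlM hminus hplus
  have hl0 : 0 < l := Nat.pos_of_ne_zero (by rintro rfl; simp at hlM)
  have hunit : ∀ v ∈ V, v ^ (2 ^ m + 1) = 1 := by
    intro v hv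
    obtain ⟨x, -, rfl⟩ := Finset.mem_image.1 hv
    have : (2 ^ m - 1) * t * (2 ^ m + 1) = (Fintype.card F - 1) * t := by rw [hcard]; ring
    rw [← pow_mul, this, pow_mul, FiniteField.pow_card_sub_one_eq_one _ x.ne_zero, one_pow]
  have hT (a b : F) : binaryExpSum F d₁ d₂ a b =
      ((l : ℤ) * (nihoCount (2 ^ m) (2 ^ k) V (a, b) : ℤ) - 1) * 2 ^ m := by
    obtain ⟨r, rfl⟩ := ht_odd
    obtain ⟨j, rfl⟩ : ∃ j, k = j + 1 := ⟨k - 1, by omega⟩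
    -- This keeps the truncated subtraction in s₁ exact and gives s₁ ≥ 1.
    have hj : 2 * r + 1 ≤ 2 ^ j * (2 * r + 1) := Nat.le_mul_of_pos_left _ (by positivity)
    simp only [Nat.add_sub_cancel] at hs₁ hs₂
    rw [hd₁, hd₂, hl]
    apply binaryExpSum_eq (by omega) hF (by omega) _ (by omega)
    have : (2 ^ (j + 1) + 1) * (2 * r + 1) + 1 =
      2 * (2 ^ j * (2 * r + 1)) + (2 * r + 1) + 1 := by ring
    rw [this]
    omega
  have hfreq (i : ℕ) : valueFrequency F d₁ d₂ (((l : ℤ) * i - 1) * 2 ^ m) =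
      (Finset.univ.filter fun ab => nihoCount (2 ^ m) (2 ^ k) V ab = i).card := by
    rw [valueFrequency]
    congr 1
    ext ab
    simp only [Finset.mem_filter, Finset.mem_univ, true_and, hT]
    have h2 : (2 : ℤ) ^ m ≠ 0 := by positivity
    have hl0' : (l : ℤ) ≠ 0 := by exact_mod_cast hl0.ne'
    rw [mul_left_inj' h2, sub_left_inj, mul_right_inj' hl0', Nat.cast_inj]
  have hlM' : (l : ℤ) * V.card = 2 ^ m + 1 := by exact_mod_cast hlM
  -- The trivial value is the case N = M; as M > 3, only (0,0) attains it.
  have hsq : (2 : ℤ) ^ (2 * m) = ((l : ℤ) * V.card - 1) * 2 ^ m := by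
    rw [hlM', two_mul, pow_add]; ring
  have hmom (j : ℕ) (hj : j ≤ 4) : V.card.choose j * (2 ^ m) ^ (4 - j) =
      V.card.choose j + ∑ i ∈ Finset.range 4,
        (Finset.univ.filter fun ab => nihoCount (2 ^ m) (2 ^ k) V ab = i).card * i.choose j := by
    rw [← sum_choose_nihoCount (by omega) hF' hkm' (by omega) hunit hj]
    exact sum_nihoCount_eq hkm' (by omega) hunit (fun n => n.choose j)
  have m0 := congrArg (Nat.cast : ℕ → ℚ) (hmom 0 (by norm_num))
  have m1 := congrArg (Nat.cast : ℕ → ℚ) (hmom 1 (by norm_num))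
  have m2 := congrArg (Nat.cast : ℕ → ℚ) (hmom 2 (by norm_num))
  have m3 := congrArg (Nat.cast : ℕ → ℚ) (hmom 3 (by norm_num))
  have choose_three_two : Nat.choose 3 2 = 3 := rfl
  simp only [Finset.sum_range_succ, Finset.sum_range_zero, Nat.choose_zero_right,
    Nat.choose_one_right, Nat.choose_self, Nat.choose_succ_self,
    Nat.choose_eq_zero_of_lt (show 1 < 3 by norm_num),
    Nat.choose_eq_zero_of_lt (show 0 < 3 by norm_num),
    Nat.choose_eq_zero_of_lt (show 0 < 2 by norm_num), choose_three_two] at m0 m1 m2 m3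
  push_cast [Nat.cast_choose_two, cast_choose_three] at m0 m1 m2 m3
  have f0 := hfreq 0
  have f1 := hfreq 1
  have f2 := hfreq 2
  have f3 := hfreq 3
  have hlQ : (l : ℚ) ≠ 0 := by exact_mod_cast hl0.ne'
  have hQ : (2 : ℚ) ^ m = l * V.card - 1 := by
    have : (l : ℚ) * V.card = 2 ^ m + 1 := by exact_mod_cast hlM
    linarith
  rw [← f0, ← f1, ← f2, ← f3] at m0
  rw [← f1, ← f2, ← f3] at m1
  rw [← f2, ← f3] at m2
  rw [← f3] at m3
  have v0 : ((l : ℤ) * (0 : ℕ) - 1) * 2 ^ m = -2 ^ m := by push_cast; ring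
  have v1 : ((l : ℤ) * (1 : ℕ) - 1) * 2 ^ m = (l - 1) * 2 ^ m := by push_cast; ring
  have v2 : ((l : ℤ) * (2 : ℕ) - 1) * 2 ^ m = (2 * l - 1) * 2 ^ m := by push_cast; ring
  have v3 : ((l : ℤ) * (3 : ℕ) - 1) * 2 ^ m = (3 * l - 1) * 2 ^ m := by push_cast; ring
  rw [v0, v1, v2, v3] at m0
  rw [v1, v2, v3] at m1
  rw [v2, v3] at m2
  rw [v3] at m3
  have p1 : (2 : ℚ) ^ (2 * m) = (2 ^ m) ^ 2 := by rw [← pow_mul, mul_comm]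
  have p2 : (2 : ℚ) ^ (2 * m + 1) = 2 * (2 ^ m) ^ 2 := by rw [pow_succ, p1]; ring
  have p3 : (2 : ℚ) ^ (m + 2) = 4 * 2 ^ m := by rw [pow_add]; ring
  rw [p1, p2, p3]
  rw [hQ] at m0 m1 m2 m3 ⊢
  simp only [pow_one, mul_zero, mul_one, zero_add] at m0 m1 m2 m3
  refine ⟨?_, ?_, ?_, ?_, ?_, ?_, ?_⟩
  · rw [hT, hsq, ← Prod.zero_eq_mk, nihoCount_zero]
  · intro a b hab
    have := nihoCount_lt_four hkm' hunit (ab := (a, b)) hab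
    rw [hT, ← v0, ← v1, ← v2, ← v3]
    interval_cases nihoCount (2 ^ m) (2 ^ k) V (a, b) <;> simp
  · rw [hsq, hfreq, Finset.card_eq_one]
    refine ⟨0, ?_⟩
    ext ab
    simp only [Finset.mem_filter, Finset.mem_univ, true_and, Finset.mem_singleton]
    constructor
    · intro h
      by_contra hab
      have := nihoCount_lt_four hkm' hunit hab
      omega
    · rintro rfl
      exact nihoCount_zero V
  -- The moment system is triangular. Here and below the coefficients are those of binomial
  -- inversion, (-1)^(j-i) C(j,i), times the cleared denominator.
  · rw [eq_div_iff (by positivity)]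
    linear_combination -(6 * (l : ℚ) ^ 3) * m3
  · rw [eq_div_iff (by positivity)]
    linear_combination -(2 * (l : ℚ) ^ 3) * (m2 - 3 * m3)
  · rw [eq_div_iff (by positivity)]
    linear_combination -(2 * (l : ℚ) ^ 3) * (m1 - 2 * m2 + 3 * m3)
  · rw [eq_div_iff (by positivity)]
    linear_combination -(6 * (l : ℚ) ^ 3) * (m0 - m1 + m2 - m3)
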